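/- Let $\eta=\mathrm{diag}(1,1,1)$ (Euclidean case) or $\eta=\mathrm{diag}(1,-1,-1)$ (Lorentzian case), let $\lambda\in\mathbb R$, and let $\mathfrak g_\lambda$ be the six-dimensional real Lie algebra with basis $J_0,J_1,J_2,P_0,P_1,P_2$ and brackets $$[J_a,J_b]=\epsilon_{abc}J^c,\qquad [J_a,P_b]=\epsilon_{abc}P^c,\qquad [P_a,P_b]=\lambda\,\epsilon_{abc}J^c ,$$ where $\epsilon_{012}=1$ and the index $c$ (which is summed over) is raised with $\eta$. In the Euclidean case $\mathfrak g_\lambda$ is $\mathfrak{so}(4)$ for $\lambda>0$, $\mathfrak{iso}(3)$ for $\lambda=0$ and $\mathfrak{so}(3,1)$ for $\lambda<0$; in the Lorentzian case it is $\mathfrak{so}(2,2)$ for $\lambda>0$, $\mathfrak{iso}(2,1)$ for $\lambda=0$ and $\mathfrak{so}(3,1)$ for $\lambda<0$. A Cartan subalgebra is a nilpotent, self-normalizing Lie subalgebra. Two subalgebras are conjugate if one is carried onto the other by an element of the adjoint group of $\mathfrak g_\lambda$, that is, the group generated by all $e^{\mathrm{ad}\,x}$, $x\in\mathfrak g_\lambda$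 (equivalently, by $\mathrm{Ad}(g)$ for some $g\in G$, where $G$ is any connected Lie group with Lie algebra $\mathfrak g_\lambda$). 1. Each of $\mathfrak{so}(4)$, $\mathfrak{so}(3,1)$ (in both presentations) and $\mathfrak{iso}(3)$ has exactly one conjugacy class of Cartan subalgebras, represented by $\mathrm{Span}\{J_0,P_0\}$. 2. $\mathfrak{iso}(2,1)$ has exactly two conjugacy classes of Cartan subalgebras, represented by $\mathrm{Span}\{J_0,P_0\}$ and $\mathrm{Span}\{J_1,P_1\}$. 3. $\mathfrak{so}(2,2)$ (any $\lambda>0$) has exactly four conjugacy classes of Cartan subalgebras, represented by $\mathrm{Span}\{J_0,P_0\}$, $\mathrm{Span}\{J_1,P_1\}$, $\mathrm{Span}\{J_0^+,J_1^-\}$ and $\mathrm{Span}\{J_1^+,J_0^-\}$, where $J_a^\pm=\tfrac12\big(J_a\pm\tfrac1{\sqrt\lambda}P_a\big)$. In particular, for the normalization $\lambda=1$, the last two representatives are $\mathrm{Span}\{J_0+P_0,\,J_1-P_1\}$ and $\mathrm{Span}\{J_1+P_1,\,J_0-P_0\}$. In each case the listed subspaces are Cartan subalgebras, every Cartan subalgebra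 is conjugate to one of them, and no two of them are conjugate to each other. -/

import Mathlib

open scoped Matrix

/-! ## The Lie algebras `𝔤_λ` -/

/-- The underlying six-dimensional real vector space of `𝔤_λ`: the pair `(m, s)` stands for
`∑ a, m a • J_a + ∑ a, s a • P_a`. The arguments (the diagonal entries of the metric `η`, and the
parameter `λ`) enter only through the Lie bracket. -/
@[nolint unusedArguments]
def GLam (_η : Fin 3 → ℝ) (_lam : ℝ) : Type := (Fin 3 → ℝ) × (Fin 3 → ℝ)

namespace GLam

/-- `(v ∧ w)_c = η_{cc} ∑_{a,b} ε_{abc} v_a w_b`: the bilinear map with `e_a ∧ e_b = ε_{abc} e^c`,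
where `e^c = η_{cc} e_c` (in the cases of interest `η_{cc} = ±1`, so `η` equals its inverse). -/
def wedge (η : Fin 3 → ℝ) (v w : Fin 3 → ℝ) : Fin 3 → ℝ := fun c => η c * (v ⨯₃ w) c

/-- The bilinear bracket determined by `[J_a, J_b] = ε_{abc} J^c`, `[J_a, P_b] = ε_{abc} P^c`,
`[P_a, P_b] = λ ε_{abc} J^c`. -/
def br (η : Fin 3 → ℝ) (lam : ℝ) (x y : (Fin 3 → ℝ) × (Fin 3 → ℝ)) :
    (Fin 3 → ℝ) × (Fin 3 → ℝ) :=
  (wedge η x.1 y.1 + lam • wedge η x.2 y.2, wedge η x.1 y.2 + wedge η x.2 y.1)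

section Bracket

variable (η : Fin 3 → ℝ) (lam : ℝ) (x y z : (Fin 3 → ℝ) × (Fin 3 → ℝ))

theorem br_add_left : br η lam (x + y) z = br η lam x z + br η lam y z := by
  ext i <;> fin_cases i <;> simp [br, wedge, cross_apply] <;> ring

theorem br_add_right : br η lam x (y + z) = br η lam x y + br η lam x z := by
  ext i <;> fin_cases i <;> simp [br, wedge, cross_apply] <;> ring

theorem br_smul_right (t : ℝ) : br η lam x (t • y) = t • br η lam x y := by
  ext i <;> fin_cases i <;> simp [br, wedge, cross_apply] <;> ring

theorem br_self : br η lam x x = 0 := by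
  ext i <;> fin_cases i <;> simp [br, wedge, cross_apply] <;> ring

theorem br_leibniz :
    br η lam x (br η lam y z) = br η lam (br η lam x y) z + br η lam y (br η lam x z) := by
  ext i <;> fin_cases i <;> simp [br, wedge, cross_apply] <;> ring

end Bracket

section Instances

variable {η : Fin 3 → ℝ} {lam : ℝ}

noncomputable instance : NormedAddCommGroup (GLam η lam) :=
  inferInstanceAs (NormedAddCommGroup ((Fin 3 → ℝ) × (Fin 3 → ℝ)))

noncomputable instance : NormedSpace ℝ (GLam η lam) :=
  inferInstanceAs (NormedSpace ℝ ((Fin 3 → ℝ) × (Fin 3 → ℝ)))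

instance : FiniteDimensional ℝ (GLam η lam) :=
  inferInstanceAs (FiniteDimensional ℝ ((Fin 3 → ℝ) × (Fin 3 → ℝ)))

noncomputable instance : LieRing (GLam η lam) where
  bracket := br η lam
  add_lie := br_add_left η lam
  lie_add := br_add_right η lam
  lie_self := br_self η lam
  leibniz_lie := br_leibniz η lam

noncomputable instance : LieAlgebra ℝ (GLam η lam) where
  lie_smul t x y := br_smul_right η lam x y t

end Instances

section Generators

variable (η : Fin 3 → ℝ) (lam : ℝ)

/-- The generator `J_a`. -/
def J (a : Fin 3) : GLam η lam := ((Pi.single a 1, 0) : (Fin 3 → ℝ) × (Fin 3 → ℝ))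

/-- The generator `P_a`. -/
def P (a : Fin 3) : GLam η lam := ((0, Pi.single a 1) : (Fin 3 → ℝ) × (Fin 3 → ℝ))

/-- `J_a⁺ = (J_a + P_a / √λ) / 2` (used for `λ > 0`). -/
noncomputable def Jplus (a : Fin 3) : GLam η lam :=
  (1 / 2 : ℝ) • (J η lam a + (1 / √lam) • P η lam a)

/-- `J_a⁻ = (J_a - P_a / √λ) / 2` (used for `λ > 0`). -/
noncomputable def Jminus (a : Fin 3) : GLam η lam :=
  (1 / 2 : ℝ) • (J η lam a - (1 / √lam) • P η lam a)

/-- The Levi-Civita symbol `ε_{abc}` with `ε_{012} = 1`. -/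
def eps (a b c : Fin 3) : ℝ :=
  if b = a + 1 ∧ c = a + 2 then 1 else if b = a + 2 ∧ c = a + 1 then -1 else 0

theorem lie_J_J (a b : Fin 3) :
    ⁅J η lam a, J η lam b⁆ = ∑ c, (eps a b c * η c) • J η lam c := by
  change br η lam (Pi.single a 1, 0) (Pi.single b 1, 0) =
    ∑ c, (eps a b c * η c) • ((Pi.single c 1, 0) : (Fin 3 → ℝ) × (Fin 3 → ℝ))
  ext i <;> fin_cases a <;> fin_cases b <;> fin_cases i <;>
    simp [br, wedge, cross_apply, eps]

theorem lie_J_P (a b : Fin 3) :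
    ⁅J η lam a, P η lam b⁆ = ∑ c, (eps a b c * η c) • P η lam c := by
  change br η lam (Pi.single a 1, 0) (0, Pi.single b 1) =
    ∑ c, (eps a b c * η c) • ((0, Pi.single c 1) : (Fin 3 → ℝ) × (Fin 3 → ℝ))
  ext i <;> fin_cases a <;> fin_cases b <;> fin_cases i <;>
    simp [br, wedge, cross_apply, eps]

theorem lie_P_P (a b : Fin 3) :
    ⁅P η lam a, P η lam b⁆ = ∑ c, (lam * eps a b c * η c) • J η lam c := by
  change br η lam (0, Pi.single a 1) (0, Pi.single b 1) =
    ∑ c, (lam * eps a b c * η c) • ((Pi.single c 1, 0) : (Fin 3 → ℝ) × (Fin 3 → ℝ))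
  ext i <;> fin_cases a <;> fin_cases b <;> fin_cases i <;>
    simp [br, wedge, cross_apply, eps]

end Generators

end GLam

/-- The Euclidean metric `diag(1, 1, 1)`. -/
def etaE : Fin 3 → ℝ := ![1, 1, 1]

/-- The Lorentzian metric `diag(1, -1, -1)`. -/
def etaL : Fin 3 → ℝ := ![1, -1, -1]

/-- The Euclidean algebra `𝔤_λ`: it is `𝔰𝔬(4)` for `λ > 0`, `𝔦𝔰𝔬(3)` for `λ = 0` and `𝔰𝔬(3,1)` for
`λ < 0`. -/
abbrev GE (lam : ℝ) : Type := GLam etaE lam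

/-- The Lorentzian algebra `𝔤_λ`: it is `𝔰𝔬(2,2)` for `λ > 0`, `𝔦𝔰𝔬(2,1)` for `λ = 0` and `𝔰𝔬(3,1)`
for `λ < 0`. -/
abbrev GL21 (lam : ℝ) : Type := GLam etaL lam

/-! ## Conjugacy of Lie subalgebras -/

section Conjugacy

variable (L : Type*) [LieRing L] [LieAlgebra ℝ L] [TopologicalSpace L]

/-- The adjoint group `Int(𝔤)`: the subgroup of `GL(𝔤)` generated by the exponentials
`e^{ad x} = ∑ₙ (ad x)ⁿ / n!`, `x ∈ 𝔤`. It is the image `Ad(G)` of the adjoint representation of any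
connected Lie group `G` with Lie algebra `𝔤`. -/
noncomputable def adjointGroup : Subgroup (L ≃ₗ[ℝ] L) :=
  Subgroup.closure
    {φ | ∃ x : L, ∀ y : L, HasSum (fun n : ℕ => ((n.factorial : ℝ)⁻¹) • ((LieAlgebra.ad ℝ L x) ^ n) y) (φ y)}

variable {L}

/-- Two Lie subalgebras are conjugate if some element of the adjoint group carries the first onto
the second. -/
def LieSubalgebra.AdConj (H K : LieSubalgebra ℝ L) : Prop :=
  ∃ φ ∈ adjointGroup L, H.toSubmodule.map (φ : L →ₗ[ℝ] L) = K.toSubmodule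

/-- The subspaces `V 0, …, V (k - 1)` are Cartan subalgebras that form a complete and irredundant
system of representatives of the conjugacy classes of Cartan subalgebras; in particular there are
exactly `k` classes. -/
def CartanRepresentatives {k : ℕ} (V : Fin k → Submodule ℝ L) : Prop :=
  ∃ H : Fin k → LieSubalgebra ℝ L,
    (∀ i, (H i).toSubmodule = V i ∧ (H i).IsCartanSubalgebra) ∧
    (∀ K : LieSubalgebra ℝ L, K.IsCartanSubalgebra → ∃ i, (H i).AdConj K) ∧
    (∀ i j, (H i).AdConj (H j) → i = j)

end Conjugacy

/-! Over R = ℝ[θ]/(θ² - λ), with P_a = θ J_a, the algebra 𝔤_λ becomes a rank three "cross product"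
algebra with an invariant R-valued form B satisfying [w,[w,y]] = B(w,y) w - B(w,w) y
(`lie_lie_self`). Hence (ad w)³ = -B(w,w) ad w, and everything is governed by the square B(u,u).

The Cartan subalgebras are exactly the lines R u with B(u,u) a unit. Such a line is its own
centralizer. Conversely, a Cartan subalgebra is its own generalized zero weight space, so it is
R-stable, and it contains some u with unit square: otherwise, for some idempotent e, every e B(x,x)
would be nilpotent, forcing e J_0 into it (`exists_not_isNilpotent`).

For conjugacy, the adjoint group is R-linear and preserves B, so the class of B(u,u) modulo squares
of scalars is an invariant of the line (`adjointGroup_isometry`). It is complete: when B(w,w) = 1,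
exp(π ad w) is the half-turn y ↦ 2B(w,y) w - y, and a half-turn about u + v interchanges two
elements of equal square whenever B(u+v,u+v) is the square of a unit.

It remains to list the classes of unit squares. For λ < 0, R ≅ ℂ and there is one. For λ = 0 they
are the signs, for λ > 0 pairs of signs, as R ≅ ℝ × ℝ. The Euclidean form allows only positive
signs, the Lorentzian one allows all. -/

/-- A diagonal metric of the form `diag(1, ε, ε)` with `ε² = 1`. -/
class IsCrossMetric (η : Fin 3 → ℝ) : Prop where
  zero : η 0 = 1
  two : η 2 = η 1
  sq : η 1 * η 1 = 1

instance : IsCrossMetric etaE := ⟨by simp [etaE], by simp [etaE], by simp [etaE]⟩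

instance : IsCrossMetric etaL := ⟨by simp [etaL], by simp [etaL], by simp [etaL]⟩

namespace GLam

/-- The algebra `ℝ[θ] / (θ² - λ)`, over which `𝔤_λ` is a three-dimensional Lie algebra, with
`θ J_a = P_a`. -/
abbrev Scal (lam : ℝ) : Type := QuadraticAlgebra ℝ lam 0

open scoped QuadraticAlgebra

/-! ### The scalar structure, the invariant form and the triple product identity -/

section Coordinates

variable {η : Fin 3 → ℝ} {lam : ℝ}

/-- The coordinates of `x` over `Scal lam` with respect to `J_0, J_1, J_2`. -/
def coord (x : GLam η lam) : Fin 3 → Scal lam := fun a => ⟨x.1 a, x.2 a⟩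

/-- The element with given coordinates. -/
def ofCoord (η : Fin 3 → ℝ) (f : Fin 3 → Scal lam) : GLam η lam :=
  (fun a => (f a).re, fun a => (f a).im)

@[simp] theorem coord_ofCoord (f : Fin 3 → Scal lam) : coord (ofCoord η f) = f := rfl

@[simp] theorem ofCoord_coord (x : GLam η lam) : ofCoord η (coord x) = x := rfl

theorem coord_injective : Function.Injective (coord : GLam η lam → Fin 3 → Scal lam) :=
  Function.LeftInverse.injective (g := ofCoord η) ofCoord_coord

instance : SMul (Scal lam) (GLam η lam) := ⟨fun r x => ofCoord η (r • coord x)⟩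

@[simp] theorem coord_zero : coord (0 : GLam η lam) = 0 := rfl

@[simp] theorem coord_add (x y : GLam η lam) : coord (x + y) = coord x + coord y := rfl

@[simp] theorem coord_neg (x : GLam η lam) : coord (-x) = -coord x := rfl

@[simp] theorem coord_sub (x y : GLam η lam) : coord (x - y) = coord x - coord y := rfl

@[simp] theorem coord_smul (r : Scal lam) (x : GLam η lam) : coord (r • x) = r • coord x := rfl

@[simp] theorem coord_real_smul (t : ℝ) (x : GLam η lam) : coord (t • x) = t • coord x := rfl

noncomputable instance : Module (Scal lam) (GLam η lam) :=
  Function.Injective.module (Scal lam)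
    ({ toFun := coord, map_zero' := coord_zero, map_add' := coord_add } :
      GLam η lam →+ (Fin 3 → Scal lam)) coord_injective coord_smul

instance : IsScalarTower ℝ (Scal lam) (GLam η lam) :=
  ⟨fun t r x => coord_injective (by simp [smul_assoc])⟩

instance : SMulCommClass ℝ (Scal lam) (GLam η lam) :=
  ⟨fun t r x => coord_injective (smul_comm t r (coord x))⟩

theorem coord_J (a : Fin 3) : coord (J η lam a) = Pi.single a 1 := by
  ext i <;> fin_cases a <;> fin_cases i <;> simp [coord, J]

theorem coord_P (a : Fin 3) : coord (P η lam a) = Pi.single a ⟨0, 1⟩ := by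
  ext i <;> fin_cases a <;> fin_cases i <;> simp [coord, P]

theorem coord_lie (x y : GLam η lam) :
    coord ⁅x, y⁆ = fun c => algebraMap ℝ (Scal lam) (η c) * (coord x ⨯₃ coord y) c := by
  change coord (br η lam x y : GLam η lam) = _
  ext c <;> fin_cases c <;> simp [coord, br, wedge, cross_apply] <;> ring

/-- The invariant bilinear form on `𝔤_λ`, with values in `Scal lam`. -/
def bil (x y : GLam η lam) : Scal lam :=
  ∑ a, algebraMap ℝ (Scal lam) (η a) * (coord x a * coord y a)

theorem bil_add_left (x y z : GLam η lam) : bil (x + y) z = bil x z + bil y z := by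
  simp [bil, Fin.sum_univ_three]; ring

theorem bil_smul_left (r : Scal lam) (x y : GLam η lam) : bil (r • x) y = r * bil x y := by
  simp [bil, Fin.sum_univ_three]; ring

theorem bil_comm (x y : GLam η lam) : bil x y = bil y x := by
  simp [bil, mul_comm]

theorem bil_add_right (x y z : GLam η lam) : bil x (y + z) = bil x y + bil x z := by
  rw [bil_comm, bil_add_left, bil_comm y, bil_comm z]

theorem bil_smul_right (r : Scal lam) (x y : GLam η lam) : bil x (r • y) = r * bil x y := by
  rw [bil_comm, bil_smul_left, bil_comm]

theorem smul_lie_scal (r : Scal lam) (x y : GLam η lam) : ⁅r • x, y⁆ = r • ⁅x, y⁆ := by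
  apply coord_injective
  funext c
  fin_cases c <;> simp [coord_lie, cross_apply] <;> ring

theorem lie_smul_scal (r : Scal lam) (x y : GLam η lam) : ⁅x, r • y⁆ = r • ⁅x, y⁆ := by
  rw [← lie_skew, smul_lie_scal, ← smul_neg, lie_skew]

theorem bil_sub_right (x y z : GLam η lam) : bil x (y - z) = bil x y - bil x z := by
  rw [eq_sub_iff_add_eq, ← bil_add_right, sub_add_cancel]

section CrossMetric

variable [hη : IsCrossMetric η]

/-- This is the vector triple product formula; the metric signs cancel because η₁² = 1. -/
theorem lie_lie_self (w y : GLam η lam) : ⁅w, ⁅w, y⁆⁆ = bil w y • w - bil w w • y := by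
  have h : algebraMap ℝ (Scal lam) (η 1) * algebraMap ℝ (Scal lam) (η 1) = 1 := by
    rw [← map_mul, hη.sq, map_one]
  apply coord_injective
  funext c
  simp only [coord_lie, coord_sub, coord_smul, bil, Fin.sum_univ_three, hη.zero, hη.two, map_one]
  fin_cases c
  · simp [cross_apply, hη.zero, hη.two]; ring
  · simp [cross_apply, hη.zero, hη.two]
    linear_combination (coord w 1 * coord w 0 * coord y 0 - coord w 0 * coord w 0 * coord y 1) * h
  · simp [cross_apply, hη.zero, hη.two]
    linear_combination (coord w 2 * coord w 0 * coord y 0 - coord w 0 * coord w 0 * coord y 2) * h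

theorem bil_lie_left (x y z : GLam η lam) : bil ⁅x, y⁆ z = -bil y ⁅x, z⁆ := by
  have h : algebraMap ℝ (Scal lam) (η 1) * algebraMap ℝ (Scal lam) (η 1) = 1 := by
    rw [← map_mul, hη.sq, map_one]
  simp only [coord_lie, bil, Fin.sum_univ_three, hη.zero, hη.two, map_one, cross_apply]
  simp
  linear_combination ((coord x 2 * coord y 0 - coord x 0 * coord y 2) * coord z 1 +
    (coord x 0 * coord y 1 - coord x 1 * coord y 0) * coord z 2 +
    (coord x 2 * coord z 0 - coord x 0 * coord z 2) * coord y 1 +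
    (coord x 0 * coord z 1 - coord x 1 * coord z 0) * coord y 2) * h

theorem bil_J_zero : bil (J η lam 0) (J η lam 0) = 1 := by
  simp [bil, coord_J, Fin.sum_univ_three, hη.zero]

theorem lie_lie_lie_self (w y : GLam η lam) : ⁅w, ⁅w, ⁅w, y⁆⁆⁆ = -(bil w w • ⁅w, y⁆) := by
  rw [lie_lie_self w y, lie_sub, lie_smul_scal, lie_self, smul_zero, zero_sub, lie_smul_scal]

end CrossMetric

end Coordinates

/-! ### Half-turns as exponentials -/

section AdjointGroup

variable {η : Fin 3 → ℝ} {lam : ℝ} [hη : IsCrossMetric η]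

theorem ad_pow_odd {w : GLam η lam} (hw : bil w w = 1) (k : ℕ) (y : GLam η lam) :
    ((LieAlgebra.ad ℝ (GLam η lam) w) ^ (2 * k + 1)) y = (-1 : ℝ) ^ k • ⁅w, y⁆ := by
  induction k with
  | zero => simp
  | succ k ih =>
    rw [show 2 * (k + 1) + 1 = (2 * k + 1) + 1 + 1 by ring, pow_succ', pow_succ',
      Module.End.mul_apply, Module.End.mul_apply, ih]
    simp [lie_lie_lie_self, hw, pow_succ, -lie_skew]

/-- Since (ad w)³ = -ad w, even powers alternate in sign on -[w,[w,y]]. The extra term at k = 0 is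
the component y + [w,[w,y]] = B(w,y) w, which ad w kills and only the zeroth power sees. -/
theorem ad_pow_even {w : GLam η lam} (hw : bil w w = 1) (k : ℕ) (y : GLam η lam) :
    ((LieAlgebra.ad ℝ (GLam η lam) w) ^ (2 * k)) y =
      (-1 : ℝ) ^ k • (-⁅w, ⁅w, y⁆⁆) + if k = 0 then y + ⁅w, ⁅w, y⁆⁆ else 0 := by
  cases k with
  | zero => simp [-lie_skew]
  | succ k =>
    rw [show 2 * (k + 1) = (2 * k + 1) + 1 by ring, pow_succ', Module.End.mul_apply,
      ad_pow_odd hw]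
    simp [pow_succ, -lie_skew]

theorem hasSum_exp_pi_ad_odd {w : GLam η lam} (hw : bil w w = 1) (y : GLam η lam) :
    HasSum (fun k : ℕ => (((2 * k + 1).factorial : ℝ)⁻¹) •
      ((LieAlgebra.ad ℝ (GLam η lam) (Real.pi • w)) ^ (2 * k + 1)) y) 0 := by
  have h := (Real.hasSum_sin Real.pi).smul_const ⁅w, y⁆
  rw [Real.sin_pi, zero_smul] at h
  convert h using 2 with k
  rw [map_smul, smul_pow, LinearMap.smul_apply, ad_pow_odd hw, smul_smul, smul_smul]
  congr 1
  ring

theorem hasSum_exp_pi_ad_even {w : GLam η lam} (hw : bil w w = 1) (y : GLam η lam) :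
    HasSum (fun k : ℕ => (((2 * k).factorial : ℝ)⁻¹) •
      ((LieAlgebra.ad ℝ (GLam η lam) (Real.pi • w)) ^ (2 * k)) y)
      (⁅w, ⁅w, y⁆⁆ + (y + ⁅w, ⁅w, y⁆⁆)) := by
  have h := ((Real.hasSum_cos Real.pi).smul_const (-⁅w, ⁅w, y⁆⁆)).add
    (hasSum_ite_eq 0 (y + ⁅w, ⁅w, y⁆⁆))
  rw [Real.cos_pi, neg_one_smul, neg_neg] at h
  convert h using 2 with k
  rw [map_smul, smul_pow, LinearMap.smul_apply, ad_pow_even hw, smul_smul, smul_add, smul_smul]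
  congr 1
  · congr 1
    ring
  · split_ifs with hk
    · simp [hk]
    · simp

/-- The odd terms sum to sin π = 0 and the even ones to cos π = -1 on the part orthogonal to w,
while w itself is fixed. -/
theorem hasSum_exp_pi_ad {w : GLam η lam} (hw : bil w w = 1) (y : GLam η lam) :
    HasSum (fun n : ℕ => ((n.factorial : ℝ)⁻¹) •
      ((LieAlgebra.ad ℝ (GLam η lam) (Real.pi • w)) ^ n) y) ((2 * bil w y) • w - y) := by
  have h := HasSum.even_add_odd (f := fun n : ℕ => ((n.factorial : ℝ)⁻¹) •
    ((LieAlgebra.ad ℝ (GLam η lam) (Real.pi • w)) ^ n) y)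
    (hasSum_exp_pi_ad_even hw y) (hasSum_exp_pi_ad_odd hw y)
  rwa [lie_lie_self, hw, one_smul, add_zero,
    show bil w y • w - y + (y + (bil w y • w - y)) = (2 * bil w y) • w - y by module] at h

theorem exists_mem_adjointGroup_halfTurn {w : GLam η lam} (hw : bil w w = 1) :
    ∃ φ ∈ adjointGroup (GLam η lam), ∀ y, φ y = (2 * bil w y) • w - y := by
  let f : GLam η lam →ₗ[ℝ] GLam η lam :=
    { toFun := fun y => (2 * bil w y) • w - y
      map_add' := fun x y => by rw [bil_add_right, mul_add, add_smul]; abel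
      map_smul' := fun t y => by
        rw [← algebraMap_smul (Scal lam) t y, bil_smul_right, RingHom.id_apply,
          ← algebraMap_smul (Scal lam) t (_ - y), smul_sub, smul_smul, mul_left_comm] }
  have hf : Function.Involutive f := fun y => by
    change (2 * bil w ((2 * bil w y) • w - y)) • w - ((2 * bil w y) • w - y) = y
    rw [bil_sub_right, bil_smul_right, hw]
    module
  exact ⟨LinearEquiv.ofInvolutive f hf,
    Subgroup.subset_closure ⟨Real.pi • w, hasSum_exp_pi_ad hw⟩, fun y => rfl⟩

end AdjointGroup

/-! ### Lines over the scalars as Cartan subalgebras -/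

section Lines

variable {η : Fin 3 → ℝ} {lam : ℝ}

theorem lie_eq_zero_of_smul (r s : Scal lam) (u : GLam η lam) : ⁅r • u, s • u⁆ = 0 := by
  rw [smul_lie_scal, lie_smul_scal, lie_self, smul_zero, smul_zero]

/-- The `Scal lam`-line through `u`, an abelian subalgebra. -/
noncomputable def line (u : GLam η lam) : LieSubalgebra ℝ (GLam η lam) where
  toSubmodule := (Submodule.span (Scal lam) {u}).restrictScalars ℝ
  lie_mem' := by
    intro x y hx hy
    obtain ⟨r, rfl⟩ := Submodule.mem_span_singleton.mp hx
    obtain ⟨s, rfl⟩ := Submodule.mem_span_singleton.mp hy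
    rw [lie_eq_zero_of_smul]
    exact Submodule.zero_mem _

theorem mem_line {u y : GLam η lam} : y ∈ line u ↔ ∃ r : Scal lam, r • u = y :=
  Submodule.mem_span_singleton

theorem line_unit_smul {r : Scal lam} (hr : IsUnit r) (u : GLam η lam) : line (r • u) = line u := by
  obtain ⟨r, rfl⟩ := hr
  ext y
  rw [mem_line, mem_line]
  constructor
  · rintro ⟨s, rfl⟩
    exact ⟨s * r, mul_smul _ _ _⟩
  · rintro ⟨s, rfl⟩
    exact ⟨s * (r⁻¹ : (Scal lam)ˣ), by rw [smul_smul, mul_assoc, Units.inv_mul, mul_one]⟩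

theorem line_toSubmodule (u : GLam η lam) :
    (line u).toSubmodule = Submodule.span ℝ {u, (⟨0, 1⟩ : Scal lam) • u} := by
  ext y
  rw [LieSubalgebra.mem_toSubmodule, mem_line, Submodule.mem_span_pair]
  constructor
  · rintro ⟨r, rfl⟩
    exact ⟨r.re, r.im, coord_injective (by ext c <;> (simp; try ring))⟩
  · rintro ⟨a, b, rfl⟩
    exact ⟨⟨a, b⟩, coord_injective (by ext c <;> (simp; try ring))⟩

instance (u : GLam η lam) : IsLieAbelian (line u) where
  trivial x y := by
    obtain ⟨r, hr⟩ := mem_line.mp x.2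
    obtain ⟨s, hs⟩ := mem_line.mp y.2
    apply Subtype.ext
    rw [LieSubalgebra.coe_bracket, ← hr, ← hs, lie_eq_zero_of_smul]
    rfl

/-- A line is abelian, so all of it normalizes K, and K is self-normalizing. -/
theorem eq_line_of_le {K : LieSubalgebra ℝ (GLam η lam)} (hK : K.IsCartanSubalgebra)
    {u : GLam η lam} (h : K ≤ line u) : K = line u := by
  refine le_antisymm h fun y hy => ?_
  rw [← hK.self_normalizing, LieSubalgebra.mem_normalizer_iff]
  intro x hx
  obtain ⟨r, rfl⟩ := mem_line.mp hy
  obtain ⟨s, rfl⟩ := mem_line.mp (h hx)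
  rw [lie_eq_zero_of_smul]
  exact K.zero_mem

/-- A Cartan subalgebra is its own generalized zero weight space. This turns membership into a
condition on powers of ad, which commute with the scalars. -/
theorem mem_cartan_iff {K : LieSubalgebra ℝ (GLam η lam)} (hK : K.IsCartanSubalgebra)
    (y : GLam η lam) :
    y ∈ K ↔ ∀ x ∈ K, ∃ k : ℕ, ((LieAlgebra.ad ℝ (GLam η lam) x) ^ k) y = 0 := by
  have h : LieAlgebra.zeroRootSubalgebra ℝ (GLam η lam) K = K :=
    LieAlgebra.zeroRootSubalgebra_eq_of_is_cartan ℝ (GLam η lam) K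
  conv_lhs => rw [← h]
  rw [LieAlgebra.mem_zeroRootSubalgebra]
  exact Subtype.forall

variable [hη : IsCrossMetric η]

theorem mem_line_of_lie_eq_zero {u y : GLam η lam} (hu : IsUnit (bil u u)) (h : ⁅u, y⁆ = 0) :
    y ∈ line u := by
  have h2 := lie_lie_self u y
  rw [h, lie_zero, eq_comm, sub_eq_zero] at h2
  obtain ⟨q, hq⟩ := hu
  refine mem_line.mpr ⟨(q⁻¹ : (Scal lam)ˣ) * bil u y, ?_⟩
  rw [mul_smul, h2, ← hq, smul_smul, Units.inv_mul, one_smul]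

/-- If [y,u] = r u then (ad u)² y = 0, so (ad u)³ y = -B(u,u) [u,y] gives [u,y] = 0, and y lies in
the centralizer of u, which is the line. -/
theorem isCartanSubalgebra_line {u : GLam η lam} (hu : IsUnit (bil u u)) :
    (line u).IsCartanSubalgebra where
  nilpotent := inferInstance
  self_normalizing := by
    refine le_antisymm (fun y hy => ?_) (LieSubalgebra.le_normalizer _)
    rw [LieSubalgebra.mem_normalizer_iff] at hy
    obtain ⟨r, hr⟩ := mem_line.mp (hy u (mem_line.mpr ⟨1, one_smul _ _⟩))
    refine mem_line_of_lie_eq_zero hu ?_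
    have h3 := lie_lie_lie_self u y
    rw [← lie_skew u y, ← hr, lie_neg, lie_smul_scal, lie_self, smul_zero, neg_zero, lie_zero,
      eq_comm, neg_eq_zero] at h3
    rw [← lie_skew, ← hr, neg_eq_zero]
    exact hu.smul_eq_zero.mp (by rwa [smul_neg, neg_eq_zero] at h3)

theorem bil_smul_lie_eq_zero {x y : GLam η lam} {k : ℕ}
    (h : ((LieAlgebra.ad ℝ (GLam η lam) x) ^ k) y = 0) :
    ∃ n : ℕ, bil x x ^ n • ⁅x, y⁆ = 0 := by
  refine ⟨k, ?_⟩
  have key : ∀ n : ℕ, ((LieAlgebra.ad ℝ (GLam η lam) x) ^ (2 * n + 1)) y =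
      (-bil x x) ^ n • ⁅x, y⁆ := by
    intro n
    induction n with
    | zero => simp
    | succ n ih =>
      rw [show 2 * (n + 1) + 1 = (2 * n + 1) + 1 + 1 by ring, pow_succ', pow_succ',
        Module.End.mul_apply, Module.End.mul_apply, ih]
      simp only [LieAlgebra.ad_apply, lie_smul_scal, lie_lie_lie_self, pow_succ, mul_smul,
        neg_smul, smul_neg]
  have h2 := key k
  rw [show 2 * k + 1 = (k + 1) + k by ring, pow_add, Module.End.mul_apply, h, map_zero, neg_pow,
    mul_smul] at h2
  exact ((isUnit_one.neg.pow k).smul_eq_zero.mp h2.symm)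

/-- If `e` is idempotent, some element `x` of a Cartan subalgebra has `e * bil x x` not
nilpotent. -/
theorem exists_not_isNilpotent {K : LieSubalgebra ℝ (GLam η lam)} (hK : K.IsCartanSubalgebra)
    {e : Scal lam} (he : e * e = e) (he0 : e ≠ 0) : ∃ x ∈ K, ¬ IsNilpotent (e * bil x x) := by
  by_contra! hcon
  have hpow : ∀ n, e ^ (n + 1) = e := fun n => IsIdempotentElem.pow_succ_eq n he
  -- If every e B(x,x) is nilpotent, each ad x with x in K is nilpotent on e J_0, which puts e J_0
  -- in K. Its own square is e, which is not nilpotent.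
  have hmem : e • J η lam 0 ∈ K := by
    rw [mem_cartan_iff hK]
    intro x hx
    obtain ⟨n, hn⟩ := hcon x hx
    have key : ∀ n : ℕ, ((LieAlgebra.ad ℝ (GLam η lam) x) ^ (2 * n + 1)) (e • J η lam 0) =
        (-1 : Scal lam) ^ n • (e * bil x x) ^ n • ⁅x, e • J η lam 0⁆ := by
      intro n
      induction n with
      | zero => simp
      | succ n ih =>
        rw [show 2 * (n + 1) + 1 = (2 * n + 1) + 1 + 1 by ring, pow_succ', pow_succ',
          Module.End.mul_apply, Module.End.mul_apply, ih]
        simp only [LieAlgebra.ad_apply, lie_smul_scal, lie_lie_lie_self, ← neg_smul,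
          smul_smul]
        congr 1
        rw [pow_succ, pow_succ]
        linear_combination ((-1) ^ n * (e * bil x x) ^ n * bil x x) * he
    exact ⟨2 * n + 1, by rw [key, hn, zero_smul, smul_zero]⟩
  obtain ⟨n, hn⟩ := hcon _ hmem
  rw [bil_smul_left, bil_smul_right, bil_J_zero, mul_one, he, he] at hn
  refine he0 ?_
  rw [← hpow n, pow_succ, hn, zero_mul]

end Lines

/-! ### The adjoint group acts by scalar-linear isometries -/

section Invariance

variable {η : Fin 3 → ℝ} {lam : ℝ}

theorem ad_pow_smul (x y : GLam η lam) (r : Scal lam) (n : ℕ) :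
    ((LieAlgebra.ad ℝ (GLam η lam) x) ^ n) (r • y) =
      r • ((LieAlgebra.ad ℝ (GLam η lam) x) ^ n) y := by
  induction n with
  | zero => simp
  | succ n ih =>
    rw [pow_succ', Module.End.mul_apply, Module.End.mul_apply, ih, LieAlgebra.ad_apply,
      lie_smul_scal, LieAlgebra.ad_apply]

/-- Multiplication by r is continuous and commutes with ad x, so it passes through the exponential
series. -/
theorem exp_ad_smul {x : GLam η lam} {φ : GLam η lam ≃ₗ[ℝ] GLam η lam}
    (hφ : ∀ y, HasSum (fun n : ℕ => ((n.factorial : ℝ)⁻¹) •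
      ((LieAlgebra.ad ℝ (GLam η lam) x) ^ n) y) (φ y)) (r : Scal lam) (y : GLam η lam) :
    φ (r • y) = r • φ y := by
  have hc : Continuous (DistribSMul.toLinearMap ℝ (GLam η lam) r) :=
    LinearMap.continuous_of_finiteDimensional _
  have h := (hφ y).map (DistribSMul.toLinearMap ℝ (GLam η lam) r) hc
  refine (hφ (r • y)).unique ?_
  convert h using 2 with n
  · rw [ad_pow_smul, smul_comm]
    rfl
  · rfl

theorem exp_neg_ad_apply {x : GLam η lam} {φ : GLam η lam ≃ₗ[ℝ] GLam η lam}
    (hφ : ∀ y, HasSum (fun n : ℕ => ((n.factorial : ℝ)⁻¹) •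
      ((LieAlgebra.ad ℝ (GLam η lam) x) ^ n) y) (φ y)) (y : GLam η lam) :
    HasSum (fun n : ℕ => ((n.factorial : ℝ)⁻¹) •
      ((LieAlgebra.ad ℝ (GLam η lam) (-x)) ^ n) (φ y)) y := by
  have : CompleteSpace (GLam η lam) := FiniteDimensional.complete ℝ _
  let _ : NormedAlgebra ℚ (GLam η lam →L[ℝ] GLam η lam) := NormedAlgebra.restrictScalars ℚ ℝ _
  let A : GLam η lam → (GLam η lam →L[ℝ] GLam η lam) := fun x =>
    LinearMap.toContinuousLinearMap (LieAlgebra.ad ℝ (GLam η lam) x)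
  have hA : ∀ x (n : ℕ) y, (A x ^ n) y = ((LieAlgebra.ad ℝ (GLam η lam) x) ^ n) y := by
    intro x n
    induction n with
    | zero => intro y; simp
    | succ n ih => intro y; rw [pow_succ, pow_succ, Module.End.mul_apply, ← ih]; rfl
  have hexp : ∀ x y, HasSum (fun n : ℕ => ((n.factorial : ℝ)⁻¹) •
      ((LieAlgebra.ad ℝ (GLam η lam) x) ^ n) y) (NormedSpace.exp (A x) y) := by
    intro x y
    have h := (NormedSpace.exp_series_hasSum_exp' (𝕂 := ℝ) (A x)).mapL
      (ContinuousLinearMap.apply ℝ (GLam η lam) y)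
    convert h using 2 with n
    · simp [hA]
    · rfl
  have hn : A (-x) = -A x := by
    ext1 y
    simp [A]
  have h1 : φ y = NormedSpace.exp (A x) y := (hφ y).unique (hexp x y)
  have h2 := hexp (-x) (φ y)
  have h3 : NormedSpace.exp (A (-x)) * NormedSpace.exp (A x) = 1 := by
    rw [hn, ← NormedSpace.exp_add_of_commute ((Commute.refl (A x)).neg_left), neg_add_cancel,
      NormedSpace.exp_zero]
  have h4 : NormedSpace.exp (A (-x)) (φ y) = y := by
    rw [h1, ← mul_apply_eq_comp, h3, one_apply_eq_self]
  rwa [h4] at h2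

/-- The real linear functional `y ↦ ℓ (bil y z)`. -/
noncomputable def bilFunctional (ℓ : Scal lam →ₗ[ℝ] ℝ) (z : GLam η lam) : GLam η lam →ₗ[ℝ] ℝ where
  toFun y := ℓ (bil y z)
  map_add' x y := by rw [bil_add_left, map_add]
  map_smul' t y := by
    rw [← algebraMap_smul (Scal lam) t y, bil_smul_left, ← Algebra.smul_def, map_smul,
      RingHom.id_apply]

variable [hη : IsCrossMetric η]

theorem bil_ad_pow (x y z : GLam η lam) (n : ℕ) :
    bil (((LieAlgebra.ad ℝ (GLam η lam) x) ^ n) y) z =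
      bil (((LieAlgebra.ad ℝ (GLam η lam) (-x)) ^ n) z) y := by
  induction n generalizing z with
  | zero => simpa using bil_comm y z
  | succ n ih =>
    rw [pow_succ', Module.End.mul_apply, pow_succ, Module.End.mul_apply, LieAlgebra.ad_apply,
      LieAlgebra.ad_apply, bil_lie_left, bil_comm, ← neg_one_mul, ← bil_smul_left, ← ih, neg_lie,
      neg_one_smul, bil_comm]

/-- As ad x is skew for B, φ = exp(ad x) has adjoint exp(-ad x), which undoes φ. The series are
summed after applying real functionals, and the two coordinate functionals recover the scalar. -/
theorem bil_exp_ad {x : GLam η lam} {φ : GLam η lam ≃ₗ[ℝ] GLam η lam}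
    (hφ : ∀ y, HasSum (fun n : ℕ => ((n.factorial : ℝ)⁻¹) •
      ((LieAlgebra.ad ℝ (GLam η lam) x) ^ n) y) (φ y)) (y z : GLam η lam) :
    bil (φ y) (φ z) = bil y z := by
  have key : ∀ ℓ : Scal lam →ₗ[ℝ] ℝ, ℓ (bil (φ y) (φ z)) = ℓ (bil y z) := by
    intro ℓ
    have h1 := (hφ y).map (bilFunctional ℓ (φ z))
      (LinearMap.continuous_of_finiteDimensional _)
    have h2 := (exp_neg_ad_apply hφ z).map (bilFunctional ℓ y)
      (LinearMap.continuous_of_finiteDimensional _)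
    have h3 : bilFunctional ℓ y z = ℓ (bil y z) := congrArg ℓ (bil_comm z y)
    rw [← h3]
    refine h1.unique ?_
    convert h2 using 1
    funext n
    rw [Function.comp_apply, Function.comp_apply, map_smul, map_smul]
    exact congrArg _ (congrArg ℓ (bil_ad_pow x y (φ z) n))
  exact QuadraticAlgebra.ext (key (QuadraticAlgebra.reₗ _ _)) (key (QuadraticAlgebra.imₗ _ _))

/-- Elements of the adjoint group are `Scal lam`-linear isometries of the form `bil`. -/
theorem adjointGroup_isometry {φ : GLam η lam ≃ₗ[ℝ] GLam η lam}
    (hφ : φ ∈ adjointGroup (GLam η lam)) :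
    (∀ (r : Scal lam) y, φ (r • y) = r • φ y) ∧ ∀ y z, bil (φ y) (φ z) = bil y z := by
  induction hφ using Subgroup.closure_induction with
  | mem φ h =>
    obtain ⟨x, hx⟩ := h
    exact ⟨exp_ad_smul hx, bil_exp_ad hx⟩
  | one => exact ⟨fun _ _ => rfl, fun _ _ => rfl⟩
  | mul φ ψ _ _ h1 h2 =>
    exact ⟨fun r y => (congrArg φ (h2.1 r y)).trans (h1.1 r (ψ y)),
      fun y z => (h1.2 _ _).trans (h2.2 y z)⟩
  | inv φ _ h =>
    have hinv : ∀ y, φ (φ⁻¹ y) = y := φ.apply_symm_apply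
    exact ⟨fun r y => φ.injective (by rw [hinv, h.1, hinv]),
      fun y z => by rw [← h.2, hinv, hinv]⟩


end Invariance

/-! ### Conjugacy of lines -/

section Conj

theorem adConj_trans {L : Type*} [LieRing L] [LieAlgebra ℝ L] [TopologicalSpace L]
    {H K M : LieSubalgebra ℝ L} (h1 : H.AdConj K) (h2 : K.AdConj M) : H.AdConj M := by
  obtain ⟨φ, hφ, h1⟩ := h1
  obtain ⟨ψ, hψ, h2⟩ := h2
  refine ⟨ψ * φ, mul_mem hψ hφ, ?_⟩
  rw [← h2, ← h1, ← Submodule.map_comp]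
  rfl

theorem adConj_symm {L : Type*} [LieRing L] [LieAlgebra ℝ L] [TopologicalSpace L]
    {H K : LieSubalgebra ℝ L} (h : H.AdConj K) : K.AdConj H := by
  obtain ⟨φ, hφ, h⟩ := h
  refine ⟨φ⁻¹, inv_mem hφ, ?_⟩
  rw [← h, ← Submodule.map_comp]
  convert Submodule.map_id _
  ext y
  exact φ.symm_apply_apply y

variable {η : Fin 3 → ℝ} {lam : ℝ} [hη : IsCrossMetric η]

/-- Conjugate lines have generators whose squares differ by the square of a scalar. -/
theorem exists_bil_eq_of_adConj {u v : GLam η lam} (h : (line u).AdConj (line v)) :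
    ∃ r : Scal lam, bil u u = r ^ 2 * bil v v := by
  obtain ⟨φ, hφ, h⟩ := h
  have hm : φ u ∈ (line v).toSubmodule :=
    h ▸ Submodule.mem_map_of_mem (mem_line.mpr ⟨1, one_smul _ _⟩)
  obtain ⟨r, hr⟩ := mem_line.mp hm
  refine ⟨r, ?_⟩
  rw [← (adjointGroup_isometry hφ).2 u u, ← hr, bil_smul_left, bil_smul_right]
  ring

theorem adConj_line_of_eq {φ : GLam η lam ≃ₗ[ℝ] GLam η lam} (hφ : φ ∈ adjointGroup (GLam η lam))
    {u v : GLam η lam} (h : φ u = v) : (line u).AdConj (line v) := by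
  refine ⟨φ, hφ, ?_⟩
  have hl := (adjointGroup_isometry hφ).1
  ext y
  rw [Submodule.mem_map, LieSubalgebra.mem_toSubmodule, mem_line]
  constructor
  · rintro ⟨x, hx, rfl⟩
    obtain ⟨r, rfl⟩ := mem_line.mp hx
    exact ⟨r, by rw [← h, ← hl]; rfl⟩
  · rintro ⟨r, rfl⟩
    exact ⟨r • u, mem_line.mpr ⟨r, rfl⟩, by rw [← h, ← hl]; rfl⟩

/-- If `u` and `v` have equal squares and `u + v` has a square that is the square of a unit, then
a half-turn about the axis `u + v` carries `u` to `v`. -/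
theorem adConj_line_of_bil_add {u v : GLam η lam} (huv : bil u u = bil v v) {s : Scal lam}
    (hs : IsUnit s) (h : bil (u + v) (u + v) = s ^ 2) : (line u).AdConj (line v) := by
  obtain ⟨s, rfl⟩ := hs
  set t : Scal lam := ((s⁻¹ : (Scal lam)ˣ) : Scal lam) with ht
  have hst : (s : Scal lam) * t = 1 := s.mul_inv
  obtain ⟨φ, hφ, hφy⟩ := exists_mem_adjointGroup_halfTurn (w := t • (u + v)) (by
    rw [bil_smul_left, bil_smul_right, h]
    linear_combination (s * t + 1) * hst)
  refine adConj_line_of_eq hφ ?_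
  have h2 : 2 * bil (u + v) u = (s : Scal lam) ^ 2 := by
    rw [← h]
    simp only [bil_add_left, bil_add_right, ← huv, bil_comm v u]
    ring
  rw [hφy, bil_smul_left, smul_smul,
    show 2 * (t * bil (u + v) u) * t = 1 by
      linear_combination t * t * h2 + (s * t + 1) * hst, one_smul]
  abel

end Conj

/-! ### Every Cartan subalgebra is a line; reduction to the classification of squares -/

section CartanLines

variable {η : Fin 3 → ℝ} {lam : ℝ}

theorem smul_mem_cartan {K : LieSubalgebra ℝ (GLam η lam)} (hK : K.IsCartanSubalgebra)
    (r : Scal lam) {y : GLam η lam} (hy : y ∈ K) : r • y ∈ K := by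
  rw [mem_cartan_iff hK] at hy ⊢
  intro x hx
  obtain ⟨k, hk⟩ := hy x hx
  exact ⟨k, by rw [ad_pow_smul, hk, smul_zero]⟩

theorem line_J (a : Fin 3) :
    (line (J η lam a)).toSubmodule = Submodule.span ℝ {J η lam a, P η lam a} := by
  rw [line_toSubmodule]
  congr 3
  apply coord_injective
  rw [coord_smul, coord_J, coord_P, ← Pi.single_smul, smul_eq_mul, mul_one]

variable [hη : IsCrossMetric η]

/-- Each y in K is killed by a power of ad u, hence B(u,u)ⁿ [u,y] = 0; cancelling the unit leaves y
in the centralizer of u. -/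
theorem eq_line_of_mem {K : LieSubalgebra ℝ (GLam η lam)} (hK : K.IsCartanSubalgebra)
    {u : GLam η lam} (hu : u ∈ K) (hq : IsUnit (bil u u)) : K = line u := by
  refine eq_line_of_le hK fun y hy => mem_line_of_lie_eq_zero hq ?_
  obtain ⟨k, hk⟩ := (mem_cartan_iff hK y).mp hy u hu
  obtain ⟨n, hn⟩ := bil_smul_lie_eq_zero hk
  exact (hq.pow n).smul_eq_zero.mp hn

theorem cartanRepresentatives_of_line {k : ℕ} {V : Fin k → Submodule ℝ (GLam η lam)}
    (v : Fin k → GLam η lam) (hV : ∀ i, V i = (line (v i)).toSubmodule)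
    (hv : ∀ i, IsUnit (bil (v i) (v i)))
    (hcomplete : ∀ u, IsUnit (bil u u) → ∃ i, (line u).AdConj (line (v i)))
    (hcartan : ∀ K : LieSubalgebra ℝ (GLam η lam), K.IsCartanSubalgebra →
      ∃ u ∈ K, IsUnit (bil u u))
    (hne : ∀ i j (r : Scal lam), bil (v i) (v i) = r ^ 2 * bil (v j) (v j) → i = j) :
    CartanRepresentatives V := by
  refine ⟨fun i => line (v i), fun i => ⟨(hV i).symm, isCartanSubalgebra_line (hv i)⟩,
    fun K hK => ?_, fun i j h => ?_⟩
  · obtain ⟨u, hu, hq⟩ := hcartan K hK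
    rw [eq_line_of_mem hK hu hq]
    obtain ⟨i, hi⟩ := hcomplete u hq
    exact ⟨i, adConj_symm hi⟩
  · obtain ⟨r, hr⟩ := exists_bil_eq_of_adConj h
    exact hne i j r hr

end CartanLines

/-! ### Negative λ: the scalars are the complex numbers -/

section Negative

theorem Scal.exists_sq_eq {lam : ℝ} (hl : lam < 0) (r : Scal lam) : ∃ s : Scal lam, s ^ 2 = r := by
  obtain ⟨k, hk, rfl⟩ : ∃ k : ℝ, 0 < k ∧ lam = -k ^ 2 :=
    ⟨√(-lam), Real.sqrt_pos.mpr (by linarith), by rw [Real.sq_sqrt (by linarith)]; ring⟩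
  -- The root is taken in ℂ through the isomorphism θ ↦ k i.
  obtain ⟨z, hz⟩ := IsAlgClosed.exists_pow_nat_eq (⟨r.re, k * r.im⟩ : ℂ) (n := 2) two_pos
  have h1 := congrArg Complex.re hz
  have h2 := congrArg Complex.im hz
  simp only [pow_two, Complex.mul_re, Complex.mul_im] at h1 h2
  refine ⟨⟨z.re, z.im / k⟩, (pow_two _).trans ?_⟩
  ext
  · simp only [QuadraticAlgebra.re_mul]
    rw [← h1]
    field_simp
    ring
  · simp only [QuadraticAlgebra.im_mul]
    field_simp
    linear_combination k * h2

theorem Scal.isUnit_of_ne_zero {lam : ℝ} (hl : lam < 0) {r : Scal lam} (hr : r ≠ 0) :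
    IsUnit r := by
  rw [QuadraticAlgebra.isUnit_iff_norm_isUnit, isUnit_iff_ne_zero, QuadraticAlgebra.norm_def]
  intro h
  apply hr
  have h1 := sq_nonneg r.re
  have h2 : 0 ≤ -lam * r.im ^ 2 := mul_nonneg (by linarith) (sq_nonneg _)
  have h3 : r.re ^ 2 = 0 := by nlinarith
  have h4 : -lam * r.im ^ 2 = 0 := by nlinarith
  ext
  · exact pow_eq_zero_iff two_ne_zero |>.mp h3
  · exact pow_eq_zero_iff two_ne_zero |>.mp
      ((mul_eq_zero.mp h4).resolve_left (by linarith))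

variable {η : Fin 3 → ℝ} {lam : ℝ} [hη : IsCrossMetric η]

theorem adConj_line_J_of_neg (hl : lam < 0) {u : GLam η lam} (hu : IsUnit (bil u u)) :
    (line u).AdConj (line (J η lam 0)) := by
  obtain ⟨s, hs⟩ := Scal.exists_sq_eq hl (bil u u)
  have hsu : IsUnit s := by rw [← hs] at hu; exact (isUnit_pow_iff two_ne_zero).mp hu
  obtain ⟨s, rfl⟩ := hsu
  set t : Scal lam := ((s⁻¹ : (Scal lam)ˣ) : Scal lam) with ht
  have hst : (s : Scal lam) * t = 1 := s.mul_inv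
  have htu : IsUnit t := ⟨s⁻¹, rfl⟩
  have h1 : bil (t • u) (t • u) = 1 := by
    rw [bil_smul_left, bil_smul_right, ← hs]
    linear_combination (s * t + 1) * hst
  have step : ∀ v : GLam η lam, bil v v = 1 →
      bil (v + J η lam 0) (v + J η lam 0) ≠ 0 → (line v).AdConj (line (J η lam 0)) := by
    intro v hv hne
    obtain ⟨r, hr⟩ := Scal.exists_sq_eq hl (bil (v + J η lam 0) (v + J η lam 0))
    have hru : IsUnit r := Scal.isUnit_of_ne_zero hl fun h => hne (by rw [← hr, h]; ring)
    exact adConj_line_of_bil_add (hv.trans bil_J_zero.symm) hru hr.symm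
  -- With v = t u normalized, B(v+J_0,v+J_0) and B(-v+J_0,-v+J_0) add up to 4, so at least one of v,
  -- -v can be turned into J_0; both span the same line.
  by_cases h : bil (t • u + J η lam 0) (t • u + J η lam 0) = 0
  · rw [← line_unit_smul htu.neg u]
    refine step _ (by rwa [bil_smul_left, bil_smul_right, ← mul_assoc, neg_mul_neg, mul_assoc,
      ← bil_smul_right, ← bil_smul_left]) fun h2 => ?_
    simp only [bil_add_left, bil_add_right, bil_smul_left, bil_smul_right, bil_J_zero] at h h1 h2
    have h4 : (4 : Scal lam) = 0 := by linear_combination h + h2 - 2 * h1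
    simpa using congrArg QuadraticAlgebra.re h4
  · rw [← line_unit_smul htu u]
    exact step _ h1 h

theorem cartanRepresentatives_of_neg (hl : lam < 0) :
    CartanRepresentatives (L := GLam η lam)
      ![Submodule.span ℝ {J η lam 0, P η lam 0}] := by
  refine cartanRepresentatives_of_line (fun _ => J η lam 0) (fun i => ?_) (fun i => ?_)
    (fun u hu => ⟨0, adConj_line_J_of_neg hl hu⟩) (fun K hK => ?_)
    (fun i j _ _ => Subsingleton.elim i j)
  · fin_cases i
    exact (line_J 0).symm
  · rw [bil_J_zero]
    exact isUnit_one
  · obtain ⟨x, hx, hn⟩ := exists_not_isNilpotent hK (mul_one (1 : Scal lam)) one_ne_zero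
    rw [one_mul] at hn
    exact ⟨x, hx, Scal.isUnit_of_ne_zero hl fun h => hn (h ▸ IsNilpotent.zero)⟩

end Negative

/-! ### Nonnegative λ: splitting the scalars into real factors -/

/-- A decomposition of `Scal lam` into real factors, up to nilpotents. -/
structure Scal.Splitting (ι : Type) (lam : ℝ) where
  /-- The projection to the real factors. -/
  χ : Scal lam →ₐ[ℝ] (ι → ℝ)
  /-- A section of the projection. -/
  σ : (ι → ℝ) →ₐ[ℝ] Scal lam
  χ_σ : ∀ f, χ (σ f) = f
  isNilpotent : ∀ r, χ r = 0 → IsNilpotent r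
  exists_sq : ∀ r, (∀ i, 0 < χ r i) → ∃ s, IsUnit s ∧ s ^ 2 = r

/-- For `λ = 0`, the scalars are the dual numbers. -/
noncomputable def Scal.splittingZero : Scal.Splitting (Fin 1) 0 where
  χ := AlgHom.ofLinearMap
    { toFun := fun r _ => r.re, map_add' := fun _ _ => rfl, map_smul' := fun _ _ => rfl } rfl
    (fun r s => by ext i; simp)
  σ := (Algebra.ofId ℝ (Scal 0)).comp (Pi.evalAlgHom ℝ (fun _ : Fin 1 => ℝ) 0)
  χ_σ f := by
    ext i
    rw [Subsingleton.elim i 0]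
    rfl
  isNilpotent r hr := by
    have h : r.re = 0 := congrFun hr 0
    refine ⟨2, (pow_two r).trans ?_⟩
    ext <;> simp [h]
  exists_sq r hr := by
    have h : 0 < r.re := hr 0
    have hs : 0 < √r.re := Real.sqrt_pos.mpr h
    -- From (a + bθ)² = a² + 2abθ when θ² = 0.
    refine ⟨⟨√r.re, r.im / (2 * √r.re)⟩, ?_, (pow_two _).trans ?_⟩
    · rw [QuadraticAlgebra.isUnit_iff_norm_isUnit, isUnit_iff_ne_zero, QuadraticAlgebra.norm_def]
      simp [h.le, h.ne']
    · ext
      · simp [h.le]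
      · simp
        field_simp
        ring

/-- For `λ = k² > 0`, the scalars are a product of two copies of `ℝ`. -/
noncomputable def Scal.splittingPos {lam k : ℝ} (hk : 0 < k) (hl : k * k = lam) :
    Scal.Splitting (Fin 2) lam where
  χ := AlgHom.ofLinearMap
    { toFun := fun r => ![r.re + k * r.im, r.re - k * r.im]
      map_add' := fun r s => by ext i; fin_cases i <;> simp <;> ring
      map_smul' := fun t r => by ext i; fin_cases i <;> simp <;> ring }
    (by ext i; fin_cases i <;> simp)
    (fun r s => by ext i; fin_cases i <;> simp [← hl] <;> ring)
  σ := AlgHom.ofLinearMap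
    { toFun := fun f => ⟨(f 0 + f 1) / 2, (f 0 - f 1) / (2 * k)⟩
      map_add' := fun f g => by ext <;> simp <;> ring
      map_smul' := fun t f => by ext <;> simp <;> ring }
    (by ext <;> simp)
    (fun f g => by ext <;> simp [← hl] <;> field_simp <;> ring)
  χ_σ f := by ext i; fin_cases i <;> simp <;> field_simp <;> ring
  isNilpotent r hr := by
    have h0 : r.re + k * r.im = 0 := congrFun hr 0
    have h1 : r.re - k * r.im = 0 := congrFun hr 1
    have h2 : k * r.im = 0 := by linarith
    have h3 : r = 0 := by
      ext
      · simp only [QuadraticAlgebra.re_zero]; linarith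
      · exact (mul_eq_zero.mp h2).resolve_left hk.ne'
    rw [h3]
    exact IsNilpotent.zero
  exists_sq r hr := by
    have h0 : 0 < r.re + k * r.im := hr 0
    have h1 : 0 < r.re - k * r.im := hr 1
    have s0 := Real.mul_self_sqrt h0.le
    have s1 := Real.mul_self_sqrt h1.le
    have p0 := Real.sqrt_pos.mpr h0
    have p1 := Real.sqrt_pos.mpr h1
    generalize √(r.re + k * r.im) = a at s0 p0
    generalize √(r.re - k * r.im) = b at s1 p1
    -- The root with components a and b, the square roots of the two components of r.
    refine ⟨⟨(a + b) / 2, (a - b) / (2 * k)⟩, ?_, (pow_two _).trans ?_⟩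
    · rw [QuadraticAlgebra.isUnit_iff_norm_isUnit, isUnit_iff_ne_zero, QuadraticAlgebra.norm_def]
      have : a * b ≠ 0 := (mul_pos p0 p1).ne'
      convert this using 1
      simp only [← hl]
      field_simp
      ring
    · ext
      · simp only [QuadraticAlgebra.re_mul, ← hl]
        field_simp
        linarith
      · simp only [QuadraticAlgebra.im_mul]
        field_simp
        linear_combination 2 * k * (s0 - s1)

namespace Scal.Splitting

variable {ι : Type} {lam : ℝ} (S : Scal.Splitting ι lam)

theorem isUnit_iff {r : Scal lam} : IsUnit r ↔ ∀ i, S.χ r i ≠ 0 := by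
  constructor
  · intro h i
    exact ((h.map S.χ).map (Pi.evalRingHom (fun _ : ι => ℝ) i)).ne_zero
  · intro h
    obtain ⟨s, hs, hsr⟩ := S.exists_sq (r ^ 2) fun i => by
      rw [map_pow, Pi.pow_apply]
      exact sq_pos_of_ne_zero (h i)
    rw [← isUnit_pow_iff two_ne_zero, ← hsr]
    exact hs.pow 2

variable {η : Fin 3 → ℝ}

/-- The element of `𝔤_λ` with prescribed real components. -/
noncomputable def lift (η : Fin 3 → ℝ) (g : ι → Fin 3 → ℝ) : GLam η lam :=
  ofCoord η fun a => S.σ fun i => g i a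

theorem bil_lift (g : ι → Fin 3 → ℝ) :
    bil (S.lift η g) (S.lift η g) = S.σ fun i => ∑ a, η a * (g i a * g i a) := by
  have h : ∀ f : ι → ℝ, ∀ c : ℝ, algebraMap ℝ (Scal lam) c * S.σ f = S.σ (fun i => c * f i) := by
    intro f c
    rw [← Algebra.smul_def, ← map_smul]
    rfl
  simp only [bil, lift, coord_ofCoord, ← map_mul, h, ← map_sum]
  rfl

theorem χ_bil (x y : GLam η lam) (i : ι) :
    S.χ (bil x y) i = ∑ a, η a * (S.χ (coord x a) i * S.χ (coord y a) i) := by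
  simp [bil]

/-- With f the signs of the components of B(u,u), the product B(u,u) f is the square of a unit;
dividing u by that unit leaves f. -/
theorem exists_normalize {u : GLam η lam} (hu : IsUnit (bil u u)) :
    ∃ f : ι → ℝ, (∀ i, f i = 1 ∨ f i = -1) ∧ ∃ v : GLam η lam, line v = line u ∧
      bil v v = S.σ f := by
  rw [S.isUnit_iff] at hu
  have hf : ∀ i, ∃ t : ℝ, (t = 1 ∨ t = -1) ∧ 0 < S.χ (bil u u) i * t := by
    intro i
    rcases lt_or_gt_of_ne (hu i) with h | h
    · exact ⟨-1, Or.inr rfl, by linarith⟩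
    · exact ⟨1, Or.inl rfl, by linarith⟩
  choose f hf hpos using hf
  refine ⟨f, hf, ?_⟩
  obtain ⟨s, ⟨s, rfl⟩, hsq⟩ := S.exists_sq (bil u u * S.σ f) fun i => by
    rw [map_mul, S.χ_σ]
    exact hpos i
  have hff : S.σ f * S.σ f = 1 := by
    rw [← map_mul, ← map_one S.σ]
    congr 1
    ext i
    rcases hf i with h | h <;> simp [h]
  set t : Scal lam := ((s⁻¹ : (Scal lam)ˣ) : Scal lam) with ht
  have hst : (s : Scal lam) * t = 1 := s.mul_inv
  refine ⟨t • u, line_unit_smul ⟨s⁻¹, rfl⟩ u, ?_⟩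
  rw [bil_smul_left, bil_smul_right]
  linear_combination (-(t * t * bil u u)) * hff - t * t * S.σ f * hsq +
    S.σ f * (s * t + 1) * hst

variable [hη : IsCrossMetric η]

/-- For each factor, K has an element whose square is nonzero in that factor. Since K is stable
under scalars, the primitive idempotents glue these into one element. -/
theorem exists_mem_cartan (S : Scal.Splitting ι lam) [Fintype ι] [DecidableEq ι] {K : LieSubalgebra ℝ (GLam η lam)}
    (hK : K.IsCartanSubalgebra) : ∃ u ∈ K, IsUnit (bil u u) := by
  let e : ι → Scal lam := fun i => S.σ (Pi.single i 1)
  have he : ∀ i j, e i * e j = if i = j then e i else 0 := by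
    intro i j
    rw [← map_mul]
    split_ifs with h
    · rw [h, ← Pi.single_mul, one_mul]
    · rw [← map_zero S.σ]
      congr 1
      ext l
      by_cases hl : l = i
      · simp [Pi.single_eq_of_ne (hl ▸ h : l ≠ j)]
      · simp [Pi.single_eq_of_ne hl]
  have hx : ∀ i, ∃ x ∈ K, S.χ (bil x x) i ≠ 0 := by
    intro i
    have he0 : e i ≠ 0 := fun h => by
      have := congrFun (S.χ_σ (Pi.single i 1)) i
      change S.χ (e i) i = _ at this
      simp [h] at this
    obtain ⟨x, hx, hn⟩ := exists_not_isNilpotent hK ((he i i).trans (if_pos rfl)) he0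
    refine ⟨x, hx, fun h => hn (S.isNilpotent _ ?_)⟩
    ext j
    rw [map_mul, S.χ_σ, Pi.mul_apply]
    by_cases hj : j = i
    · subst hj
      rw [h, mul_zero]
      rfl
    · rw [Pi.single_eq_of_ne hj, zero_mul]
      rfl
  choose x hxK hx using hx
  refine ⟨∑ i, e i • x i, sum_mem fun i _ => smul_mem_cartan hK _ (hxK i), ?_⟩
  rw [S.isUnit_iff]
  intro j
  have h1 : e j • ∑ i, e i • x i = e j • x j := by
    rw [Finset.smul_sum, Finset.sum_eq_single j]
    · rw [smul_smul, he, if_pos rfl]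
    · intro i _ hij
      rw [smul_smul, he, if_neg hij.symm, zero_smul]
    · simp
  have h2 := congrArg (fun y => S.χ (bil y y) j) h1
  simp only [bil_smul_left, bil_smul_right, map_mul, Pi.mul_apply] at h2
  have h3 : S.χ (e j) j = 1 := by
    rw [S.χ_σ, Pi.single_eq_same]
  rw [h3, one_mul, one_mul, one_mul, one_mul] at h2
  rw [h2]
  exact hx j

/-- Changing the sign of u factor by factor preserves its line and square and makes B(u,v) equal to
its absolute value. Then u + v has square 2(f + |B(u,v)|), positive in every factor, and a half-turn
applies. -/
theorem adConj_of_pos {u v : GLam η lam} {f : ι → ℝ} (hu : bil u u = S.σ f)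
    (hv : bil v v = S.σ f) (h : ∀ i, 0 < f i + |S.χ (bil u v) i|) :
    (line u).AdConj (line v) := by
  let ε : ι → ℝ := fun i => if 0 ≤ S.χ (bil u v) i then 1 else -1
  have hε : ∀ i, ε i * S.χ (bil u v) i = |S.χ (bil u v) i| := by
    intro i
    by_cases h0 : 0 ≤ S.χ (bil u v) i
    · simp [ε, h0, abs_of_nonneg h0]
    · simp [ε, h0, abs_of_neg (not_le.mp h0)]
  have hεε : S.σ ε * S.σ ε = 1 := by
    rw [← map_mul, ← map_one S.σ]
    congr 1
    ext i
    by_cases h0 : 0 ≤ S.χ (bil u v) i <;> simp [ε, h0]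
  have huε : bil (S.σ ε • u) (S.σ ε • u) = bil v v := by
    rw [bil_smul_left, bil_smul_right, ← mul_assoc, hεε, one_mul, hu, hv]
  have hsum : bil (S.σ ε • u + v) (S.σ ε • u + v) = 2 * (S.σ f + S.σ ε * bil u v) := by
    rw [bil_add_left, bil_add_right, bil_add_right, huε, hv, bil_comm v, bil_smul_left]
    ring
  obtain ⟨s, hs, hsq⟩ := S.exists_sq (bil (S.σ ε • u + v) (S.σ ε • u + v)) fun i => by
    rw [hsum, two_mul, map_add, map_add, map_mul, S.χ_σ, S.χ_σ]
    simp only [Pi.add_apply, Pi.mul_apply, hε]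
    linarith [h i]
  rw [← line_unit_smul (IsUnit.of_mul_eq_one _ hεε) u]
  exact adConj_line_of_bil_add huε hs hsq.symm

end Scal.Splitting

/-! ### Euclidean metric with λ ≥ 0: positivity leaves one class -/

section Euclidean

variable {ι : Type} {lam : ℝ}

theorem cartanRepresentatives_etaE [Fintype ι] [DecidableEq ι] (S : Scal.Splitting ι lam) :
    CartanRepresentatives (L := GE lam)
      ![Submodule.span ℝ {J etaE lam 0, P etaE lam 0}] := by
  refine cartanRepresentatives_of_line (fun _ => J etaE lam 0) (fun i => ?_) (fun i => ?_)
    (fun u hu => ⟨0, ?_⟩) (fun K hK => S.exists_mem_cartan hK)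
    (fun i j _ _ => Subsingleton.elim i j)
  · fin_cases i
    exact (line_J 0).symm
  · rw [bil_J_zero]
    exact isUnit_one
  · obtain ⟨f, hf, v, hvu, hv⟩ := S.exists_normalize hu
    have hf1 : f = 1 := by
      ext i
      refine (hf i).resolve_right fun h => ?_
      have h2 := congrFun (congrArg S.χ hv) i
      rw [S.χ_σ, S.χ_bil, h] at h2
      have h3 : 0 ≤ ∑ a, etaE a * (S.χ (coord v a) i * S.χ (coord v a) i) :=
        Finset.sum_nonneg fun a _ => mul_nonneg (by fin_cases a <;> simp [etaE])
          (mul_self_nonneg _)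
      linarith
    rw [← hvu]
    refine S.adConj_of_pos hv (by rw [bil_J_zero, hf1, map_one]) fun i => ?_
    rw [hf1, Pi.one_apply]
    positivity

end Euclidean

/-! ### Lorentzian metric with λ ≥ 0: one class per choice of signs -/

section Lorentzian

/-- The reference vector of Lorentzian square `t`, for `t = ± 1`. -/
noncomputable def refVec (t : ℝ) : Fin 3 → ℝ := if t = 1 then ![1, 0, 0] else ![0, 1, 0]

/-- Any spacelike unit vector can be carried to `± e₁` by two half-turns about timelike axes; this
is the middle point. -/
theorem exists_intermediate (c : Fin 3 → ℝ) (hc : ∑ a, etaL a * (c a * c a) = -1) :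
    ∃ b : Fin 3 → ℝ, ∑ a, etaL a * (b a * b a) = -1 ∧
      0 < -1 + |∑ a, etaL a * (c a * b a)| ∧ 0 < -1 + |∑ a, etaL a * (b a * refVec (-1) a)| := by
  have href : refVec (-1) = ![0, 1, 0] := by
    rw [refVec, if_neg (by norm_num)]
  obtain ⟨s, hs, hs0⟩ : ∃ s : ℝ, s * s = 1 ∧ 0 ≤ -(c 0 * s) := by
    rcases le_total (c 0) 0 with h | h
    · exact ⟨1, by norm_num, by linarith⟩
    · exact ⟨-1, by norm_num, by linarith⟩
  obtain ⟨p, hp, hp0⟩ : ∃ s : ℝ, s * s = 1 ∧ 0 ≤ c 1 * s := by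
    rcases le_total 0 (c 1) with h | h
    · exact ⟨1, by norm_num, by linarith⟩
    · exact ⟨-1, by norm_num, by linarith⟩
  obtain ⟨q, hq, hq0⟩ : ∃ s : ℝ, s * s = 1 ∧ 0 ≤ c 2 * s := by
    rcases le_total 0 (c 2) with h | h
    · exact ⟨1, by norm_num, by linarith⟩
    · exact ⟨-1, by norm_num, by linarith⟩
  simp only [Fin.sum_univ_three, etaL, href] at hc ⊢
  simp at hc
  -- The triples (5,12,13) and (3,4,5) give (12/5)² - (13/5)²((4/5)² + (3/5)²) = -1. The signs s, p,
  -- q make all terms of the product with c nonpositive, so its absolute value is at least 39/25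
  -- (|c₁| + |c₂|) ≥ 39/25; the product with e₁ is ±52/25.
  refine ⟨![12 / 5 * s, 52 / 25 * p, 39 / 25 * q], ?_, ?_, ?_⟩
  · simp
    linear_combination 144 / 25 * hs - 2704 / 625 * hp - 1521 / 625 * hq
  · simp
    have h1 : (c 1 * p) * (c 1 * p) = c 1 * c 1 := by linear_combination c 1 * c 1 * hp
    have h2 : (c 2 * q) * (c 2 * q) = c 2 * c 2 := by linear_combination c 2 * c 2 * hq
    have h3 : 1 ≤ c 1 * p + c 2 * q := by nlinarith [mul_self_nonneg (c 0), mul_nonneg hp0 hq0]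
    rw [abs_of_neg] <;> linarith
  · simp
    rcases mul_self_eq_one_iff.mp hp with h | h <;> norm_num [h]

variable {ι : Type} {lam : ℝ} (S : Scal.Splitting ι lam)

namespace Scal.Splitting

/-- The reference element with squares `f`. -/
noncomputable def ref (f : ι → ℝ) : GL21 lam := S.lift etaL fun i => refVec (f i)

theorem bil_ref {f : ι → ℝ} (hf : ∀ i, f i = 1 ∨ f i = -1) : bil (S.ref f) (S.ref f) = S.σ f := by
  rw [ref, bil_lift]
  congr 1
  ext i
  rcases hf i with h | h <;> rw [h] <;> norm_num [refVec, Fin.sum_univ_three, etaL] <;>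
    exact Or.inr rfl

theorem χ_coord_lift (η : Fin 3 → ℝ) (g : ι → Fin 3 → ℝ) (i : ι) (a : Fin 3) :
    S.χ (coord (S.lift η g) a) i = g i a := by
  rw [lift, coord_ofCoord, S.χ_σ]

theorem adConj_ref {f : ι → ℝ} (hf : ∀ i, f i = 1 ∨ f i = -1) {u : GL21 lam}
    (hu : bil u u = S.σ f) : (line u).AdConj (line (S.ref f)) := by
  have key : ∀ i, ∃ b : Fin 3 → ℝ, ∑ a, etaL a * (b a * b a) = f i ∧
      0 < f i + |∑ a, etaL a * (S.χ (coord u a) i * b a)| ∧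
      0 < f i + |∑ a, etaL a * (b a * refVec (f i) a)| := by
    intro i
    rcases hf i with h | h
    · rw [h]
      -- In a timelike factor the positivity condition is automatic, so any unit timelike vector
      -- serves as the intermediate one.
      exact ⟨![1, 0, 0], by simp [Fin.sum_univ_three, etaL], by positivity, by positivity⟩
    · rw [h]
      refine exists_intermediate _ ?_
      rw [← χ_bil, hu, S.χ_σ, h]
  choose b hb1 hb2 hb3 using key
  have hb : bil (S.lift etaL b) (S.lift etaL b) = S.σ f := by
    rw [bil_lift]
    congr 1
    ext i
    exact hb1 i
  refine adConj_trans (S.adConj_of_pos (v := S.lift etaL b) hu hb fun i => ?_)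
    (S.adConj_of_pos hb (S.bil_ref hf) fun i => ?_)
  · simpa only [χ_bil, χ_coord_lift] using hb2 i
  · simpa only [χ_bil, χ_coord_lift, ref] using hb3 i

theorem cartanRepresentatives_etaL [Fintype ι] [DecidableEq ι] {k : ℕ}
    {V : Fin k → Submodule ℝ (GL21 lam)} (F : Fin k → ι → ℝ)
    (hF : ∀ j i, F j i = 1 ∨ F j i = -1) (hinj : Function.Injective F)
    (hsurj : ∀ f : ι → ℝ, (∀ i, f i = 1 ∨ f i = -1) → ∃ j, F j = f)
    (hV : ∀ j, V j = (line (S.ref (F j))).toSubmodule) : CartanRepresentatives V := by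
  refine cartanRepresentatives_of_line (fun j => S.ref (F j)) hV (fun j => ?_) (fun u hu => ?_)
    (fun K hK => S.exists_mem_cartan hK) (fun i j r h => hinj ?_)
  · rw [bil_ref S (hF j), isUnit_iff]
    intro i
    rw [S.χ_σ]
    rcases hF j i with h | h <;> simp [h]
  · obtain ⟨f, hf, v, hvu, hv⟩ := S.exists_normalize hu
    obtain ⟨j, rfl⟩ := hsurj f hf
    exact ⟨j, hvu ▸ S.adConj_ref hf hv⟩
  · rw [bil_ref S (hF i), bil_ref S (hF j)] at h
    ext l
    have h2 := congrFun (congrArg S.χ h) l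
    rw [map_mul, map_pow, S.χ_σ, S.χ_σ, Pi.mul_apply, Pi.pow_apply] at h2
    -- Unequal signs would make a real square equal to -1.
    rcases hF i l with h3 | h3 <;> rcases hF j l with h4 | h4 <;> rw [h3, h4] at h2 ⊢ <;>
      nlinarith [sq_nonneg (S.χ r l)]

end Scal.Splitting

theorem cartanRepresentatives_etaL_zero :
    CartanRepresentatives (L := GL21 0)
      ![Submodule.span ℝ {J etaL 0 0, P etaL 0 0}, Submodule.span ℝ {J etaL 0 1, P etaL 0 1}] := by
  refine Scal.splittingZero.cartanRepresentatives_etaL ![fun _ => 1, fun _ => -1] ?_ ?_ ?_ ?_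
  · intro j i
    fin_cases j <;> simp
  · intro i j h
    have := congrFun h 0
    fin_cases i <;> fin_cases j <;> simp at this ⊢ <;> norm_num at this
  · intro f hf
    rcases hf 0 with h | h
    · exact ⟨0, funext fun i => by rw [Subsingleton.elim i 0, h]; rfl⟩
    · exact ⟨1, funext fun i => by rw [Subsingleton.elim i 0, h]; rfl⟩
  · intro j
    fin_cases j
    · refine (line_J 0).symm.trans (congrArg (fun u => (line u).toSubmodule) ?_)
      apply coord_injective
      rw [coord_J, Scal.Splitting.ref, Scal.Splitting.lift, coord_ofCoord]
      ext a <;> fin_cases a <;> simp [Scal.splittingZero, refVec]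
    · refine (line_J 1).symm.trans (congrArg (fun u => (line u).toSubmodule) ?_)
      apply coord_injective
      have : (-1 : ℝ) ≠ 1 := by norm_num
      rw [coord_J, Scal.Splitting.ref, Scal.Splitting.lift, coord_ofCoord]
      ext a <;> fin_cases a <;> simp [Scal.splittingZero, refVec, this]

end Lorentzian

/-! ### Lorentzian metric with λ > 0: the four explicit representatives -/

section Split

variable {η : Fin 3 → ℝ} {lam k : ℝ}

/-- The two scalars are the idempotents (1 ± θ/k)/2 of ℝ × ℝ. A scalar acts on each through a single
real component, and the two components can be chosen independently. -/
theorem line_idempotents (hk : 0 < k) (hl : k * k = lam) (x y : GLam η lam) :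
    (line ((⟨1 / 2, 1 / (2 * k)⟩ : Scal lam) • x +
      (⟨1 / 2, -(1 / (2 * k))⟩ : Scal lam) • y)).toSubmodule =
    Submodule.span ℝ {(⟨1 / 2, 1 / (2 * k)⟩ : Scal lam) • x,
      (⟨1 / 2, -(1 / (2 * k))⟩ : Scal lam) • y} := by
  have hp : ∀ a b : ℝ, (⟨(a + b) / 2, (a - b) / (2 * k)⟩ : Scal lam) * ⟨1 / 2, 1 / (2 * k)⟩ =
      a • ⟨1 / 2, 1 / (2 * k)⟩ := by
    intro a b
    ext <;> simp [← hl] <;> field_simp <;> ring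
  have hm : ∀ a b : ℝ, (⟨(a + b) / 2, (a - b) / (2 * k)⟩ : Scal lam) *
      ⟨1 / 2, -(1 / (2 * k))⟩ = b • ⟨1 / 2, -(1 / (2 * k))⟩ := by
    intro a b
    ext <;> simp [← hl] <;> field_simp <;> ring
  ext z
  rw [LieSubalgebra.mem_toSubmodule, mem_line, Submodule.mem_span_pair]
  constructor
  · rintro ⟨r, rfl⟩
    refine ⟨r.re + k * r.im, r.re - k * r.im, ?_⟩
    rw [← smul_assoc, ← smul_assoc, ← hp _ (r.re - k * r.im), ← hm (r.re + k * r.im), mul_smul,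
      mul_smul, ← smul_add]
    congr 1
    ext
    · simp
    · simp
      field_simp
      ring
  · rintro ⟨a, b, rfl⟩
    refine ⟨⟨(a + b) / 2, (a - b) / (2 * k)⟩, ?_⟩
    rw [smul_add, ← mul_smul, ← mul_smul, hp, hm, smul_assoc, smul_assoc]

theorem cartanRepresentatives_etaL_pos (hk : 0 < k) (hl : k * k = lam) :
    CartanRepresentatives (L := GL21 lam)
      ![Submodule.span ℝ {J etaL lam 0, P etaL lam 0},
        Submodule.span ℝ {J etaL lam 1, P etaL lam 1},
        Submodule.span ℝ {(⟨1 / 2, 1 / (2 * k)⟩ : Scal lam) • J etaL lam 0,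
          (⟨1 / 2, -(1 / (2 * k))⟩ : Scal lam) • J etaL lam 1},
        Submodule.span ℝ {(⟨1 / 2, 1 / (2 * k)⟩ : Scal lam) • J etaL lam 1,
          (⟨1 / 2, -(1 / (2 * k))⟩ : Scal lam) • J etaL lam 0}] := by
  have h1 : (-1 : ℝ) ≠ 1 := by norm_num
  refine (Scal.splittingPos hk hl).cartanRepresentatives_etaL
    ![![1, 1], ![-1, -1], ![1, -1], ![-1, 1]] ?_ ?_ ?_ ?_
  · intro j i
    fin_cases j <;> fin_cases i <;> simp
  · intro i j h
    have h2 := congrFun h 0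
    have h3 := congrFun h 1
    fin_cases i <;> fin_cases j <;> simp at h2 h3 ⊢ <;> linarith
  · intro f hf
    rcases hf 0 with h | h <;> rcases hf 1 with h' | h'
    · exact ⟨0, by ext i; fin_cases i <;> simp [h, h']⟩
    · exact ⟨2, by ext i; fin_cases i <;> simp [h, h']⟩
    · exact ⟨3, by ext i; fin_cases i <;> simp [h, h']⟩
    · exact ⟨1, by ext i; fin_cases i <;> simp [h, h']⟩
  · intro j
    fin_cases j
    · refine (line_J 0).symm.trans (congrArg (fun u => (line u).toSubmodule) ?_)
      apply coord_injective
      rw [coord_J, Scal.Splitting.ref, Scal.Splitting.lift, coord_ofCoord]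
      ext a <;> fin_cases a <;> simp [Scal.splittingPos, refVec]
    · refine (line_J 1).symm.trans (congrArg (fun u => (line u).toSubmodule) ?_)
      apply coord_injective
      rw [coord_J, Scal.Splitting.ref, Scal.Splitting.lift, coord_ofCoord]
      ext a <;> fin_cases a <;> simp [Scal.splittingPos, refVec, h1]
    · refine (line_idempotents hk hl _ _).symm.trans
        (congrArg (fun u => (line u).toSubmodule) ?_)
      apply coord_injective
      rw [coord_add, coord_smul, coord_smul, coord_J, coord_J, Scal.Splitting.ref,
        Scal.Splitting.lift, coord_ofCoord]
      ext a <;> fin_cases a <;> simp [Scal.splittingPos, refVec, h1] <;> ring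
    · refine (line_idempotents hk hl _ _).symm.trans
        (congrArg (fun u => (line u).toSubmodule) ?_)
      apply coord_injective
      rw [coord_add, coord_smul, coord_smul, coord_J, coord_J, Scal.Splitting.ref,
        Scal.Splitting.lift, coord_ofCoord]
      ext a <;> fin_cases a <;> simp [Scal.splittingPos, refVec, h1] <;> ring

theorem Jplus_eq_smul (a : Fin 3) :
    Jplus η lam a = (⟨1 / 2, 1 / (2 * √lam)⟩ : Scal lam) • J η lam a := by
  apply coord_injective
  rw [Jplus, coord_real_smul, coord_add, coord_real_smul, coord_smul, coord_J, coord_P]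
  ext i <;> by_cases hi : i = a <;> simp [hi, mul_comm]

theorem Jminus_eq_smul (a : Fin 3) :
    Jminus η lam a = (⟨1 / 2, -(1 / (2 * √lam))⟩ : Scal lam) • J η lam a := by
  apply coord_injective
  rw [Jminus, coord_real_smul, coord_sub, coord_real_smul, coord_smul, coord_J, coord_P]
  ext i <;> by_cases hi : i = a <;> simp [hi, mul_comm]

theorem cartanRepresentatives_etaL_Jplus_Jminus (hlam : 0 < lam) :
    CartanRepresentatives (L := GL21 lam)
      ![Submodule.span ℝ {J etaL lam 0, P etaL lam 0},
        Submodule.span ℝ {J etaL lam 1, P etaL lam 1},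
        Submodule.span ℝ {Jplus etaL lam 0, Jminus etaL lam 1},
        Submodule.span ℝ {Jplus etaL lam 1, Jminus etaL lam 0}] := by
  simp only [Jplus_eq_smul, Jminus_eq_smul]
  exact cartanRepresentatives_etaL_pos (Real.sqrt_pos.mpr hlam) (Real.mul_self_sqrt hlam.le)

theorem span_half_smul_pair {M : Type*} [AddCommGroup M] [Module ℝ M] (x y : M) :
    Submodule.span ℝ {(1 / 2 : ℝ) • x, (1 / 2 : ℝ) • y} = Submodule.span ℝ {x, y} := by
  rw [Submodule.span_insert, Submodule.span_insert,
    Submodule.span_singleton_smul_eq (by norm_num), Submodule.span_singleton_smul_eq (by norm_num)]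

theorem cartanRepresentatives_etaL_one :
    CartanRepresentatives (L := GL21 1)
      ![Submodule.span ℝ {J etaL 1 0, P etaL 1 0},
        Submodule.span ℝ {J etaL 1 1, P etaL 1 1},
        Submodule.span ℝ {J etaL 1 0 + P etaL 1 0, J etaL 1 1 - P etaL 1 1},
        Submodule.span ℝ {J etaL 1 1 + P etaL 1 1, J etaL 1 0 - P etaL 1 0}] := by
  have h := cartanRepresentatives_etaL_Jplus_Jminus (lam := 1) one_pos
  simpa only [Jplus, Jminus, Real.sqrt_one, div_one, one_smul, span_half_smul_pair] using h

end Split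

end GLam

theorem mainTheorem7 :
    -- `𝔰𝔬(4)`
    (∀ lam : ℝ, 0 < lam → CartanRepresentatives (L := GE lam)
      ![Submodule.span ℝ {GLam.J etaE lam 0, GLam.P etaE lam 0}]) ∧
    -- `𝔰𝔬(3,1)`, in its Euclidean and in its Lorentzian presentation
    (∀ lam : ℝ, lam < 0 → CartanRepresentatives (L := GE lam)
      ![Submodule.span ℝ {GLam.J etaE lam 0, GLam.P etaE lam 0}]) ∧
    (∀ lam : ℝ, lam < 0 → CartanRepresentatives (L := GL21 lam)
      ![Submodule.span ℝ {GLam.J etaL lam 0, GLam.P etaL lam 0}]) ∧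
    -- `𝔦𝔰𝔬(3)`
    (CartanRepresentatives (L := GE 0)
      ![Submodule.span ℝ {GLam.J etaE 0 0, GLam.P etaE 0 0}]) ∧
    -- `𝔦𝔰𝔬(2,1)`
    (CartanRepresentatives (L := GL21 0)
      ![Submodule.span ℝ {GLam.J etaL 0 0, GLam.P etaL 0 0},
        Submodule.span ℝ {GLam.J etaL 0 1, GLam.P etaL 0 1}]) ∧
    -- `𝔰𝔬(2,2)`, for every `λ > 0`
    (∀ lam : ℝ, 0 < lam → CartanRepresentatives (L := GL21 lam)
      ![Submodule.span ℝ {GLam.J etaL lam 0, GLam.P etaL lam 0},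
        Submodule.span ℝ {GLam.J etaL lam 1, GLam.P etaL lam 1},
        Submodule.span ℝ {GLam.Jplus etaL lam 0, GLam.Jminus etaL lam 1},
        Submodule.span ℝ {GLam.Jplus etaL lam 1, GLam.Jminus etaL lam 0}]) ∧
    -- `𝔰𝔬(2,2)`, normalized to `λ = 1`
    (CartanRepresentatives (L := GL21 1)
      ![Submodule.span ℝ {GLam.J etaL 1 0, GLam.P etaL 1 0},
        Submodule.span ℝ {GLam.J etaL 1 1, GLam.P etaL 1 1},
        Submodule.span ℝ {GLam.J etaL 1 0 + GLam.P etaL 1 0, GLam.J etaL 1 1 - GLam.P etaL 1 1},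
        Submodule.span ℝ {GLam.J etaL 1 1 + GLam.P etaL 1 1,
          GLam.J etaL 1 0 - GLam.P etaL 1 0}]) := by
  refine ⟨fun lam hlam => ?_, fun lam hlam => GLam.cartanRepresentatives_of_neg hlam,
    fun lam hlam => GLam.cartanRepresentatives_of_neg hlam,
    GLam.cartanRepresentatives_etaE GLam.Scal.splittingZero,
    GLam.cartanRepresentatives_etaL_zero,
    fun lam hlam => GLam.cartanRepresentatives_etaL_Jplus_Jminus hlam,
    GLam.cartanRepresentatives_etaL_one⟩
  exact GLam.cartanRepresentatives_etaE
    (GLam.Scal.splittingPos (Real.sqrt_pos.mpr hlam) (Real.mul_self_sqrt hlam.le))
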